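/- Let $A$ be a finite set with $|A|\ge 3$. For a set $F$ of mappings $A\to A$ let $\mathrm{Con}(A,F)$ be the set of all equivalence relations $\kappa$ on $A$ such that $(x,y)\in\kappa$ implies $(gx,gy)\in\kappa$ for all $g\in F$; write $\mathrm{Con}(A,g)$ for $\mathrm{Con}(A,\{g\})$. Let $\mathcal{E}=\{\mathrm{Con}(A,F)\mid F\subseteq A^A\}$, ordered by inclusion; it is a lattice whose meet is intersection and whose greatest element is the set $\mathrm{Eq}(A)$ of all equivalence relations on $A$. **Proposition 4.4.** Let $p$ be a prime, $m\ge 0$, and let $f$ be a permutation of $A$ of order $p^m$ that has at least two cycles of length $p^m$. (Fixed points count as cycles of length $1$.) Then the principal filter $\{E\in\mathcal{E}\mid \mathrm{Con}(A,f)\subseteq E\}$ is a chain. Every element $E$ of this filter is of the form $E=\mathrm{Con}(A,f^k)$ for some integer $k\ge 1$, and every $E\ne\mathrm{Eq}(A)$ in it is meet-irreducible in $\mathcal{E}$ (that is, $E=X\cap Y$ with $X,Y\in\mathcal{E}$ implies $E=X$ or $E=Y$). -/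

import Mathlib

/-- `Con(A,F)`: the set of all equivalence relations on `A` that are preserved by every unary
mapping `f ∈ F`. -/
def ConSet (A : Type*) (F : Set (A → A)) : Set (Setoid A) :=
  {κ | ∀ f ∈ F, ∀ x y : A, κ x y → κ (f x) (f y)}

/-- `𝓔`: the set of all `Con(A,F)` with `F ⊆ A^A`, as a type. -/
def CongLattices (A : Type*) : Type _ :=
  {E : Set (Setoid A) // ∃ F : Set (A → A), E = ConSet A F}

namespace CongLattices

/-- The underlying set of equivalence relations of an element of `𝓔`. -/
def carrier {A : Type*} (E : CongLattices A) : Set (Setoid A) := E.1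

/-- `Con(A,F)` as an element of `𝓔`. -/
def con {A : Type*} (F : Set (A → A)) : CongLattices A := ⟨ConSet A F, F, rfl⟩

/-- `𝓔` is ordered by inclusion. -/
instance (A : Type*) : PartialOrder (CongLattices A) where
  le E E' := E.carrier ⊆ E'.carrier
  le_refl _ := subset_rfl
  le_trans _ _ _ := Set.Subset.trans
  le_antisymm _ _ h h' := Subtype.ext (Set.Subset.antisymm h h')

theorem iInter_eq_conSet (A : Type*) (S : Set (CongLattices A)) :
    (⋂ E ∈ S, E.carrier) = ConSet A {f | ∃ E ∈ S, ∃ F, E.carrier = ConSet A F ∧ f ∈ F} := by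
  ext κ
  simp only [Set.mem_iInter]
  constructor
  · rintro h f ⟨E, hE, F, hF, hf⟩
    have := h E hE
    rw [hF] at this
    exact this f hf
  · intro h E hE
    obtain ⟨F, hF⟩ := E.2
    have hF' : E.carrier = ConSet A F := hF
    rw [hF']
    exact fun f hf => h f ⟨E, hE, F, hF', hf⟩

/-- Infima in `𝓔` are intersections. -/
instance (A : Type*) : InfSet (CongLattices A) where
  sInf S := ⟨⋂ E ∈ S, E.carrier, _, iInter_eq_conSet A S⟩

theorem isGLB_sInf' (A : Type*) (S : Set (CongLattices A)) : IsGLB S (sInf S) :=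
  ⟨fun _ hE => Set.biInter_subset_of_mem hE, fun _ h => Set.subset_iInter₂ fun _ hE => h hE⟩

theorem inter_eq_conSet (A : Type*) (E E' : CongLattices A) :
    ∃ F, E.carrier ∩ E'.carrier = ConSet A F := by
  obtain ⟨_, F, rfl⟩ := E
  obtain ⟨_, F', rfl⟩ := E'
  refine ⟨F ∪ F', ?_⟩
  ext κ
  exact ⟨fun h f hf => hf.elim (h.1 f) (h.2 f),
    fun h => ⟨fun f hf => h f (Or.inl hf), fun f hf => h f (Or.inr hf)⟩⟩

/-- `𝓔` is a complete lattice under inclusion; the meet of two elements is their intersection. -/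
instance (A : Type*) : CompleteLattice (CongLattices A) where
  __ := completeLatticeOfInf (CongLattices A) (isGLB_sInf' A)
  inf E E' := ⟨E.carrier ∩ E'.carrier, inter_eq_conSet A E E'⟩
  inf_le_left _ _ := Set.inter_subset_left
  inf_le_right _ _ := Set.inter_subset_right
  le_inf _ _ _ := Set.subset_inter

end CongLattices

/-- The top element of `𝓔` is `Eq(A)`, the set of all equivalence relations. -/
theorem CongLattices.carrier_top (A : Type*) : (⊤ : CongLattices A).carrier = Set.univ := by
  refine Set.eq_univ_of_univ_subset ?_
  have h : CongLattices.con (∅ : Set (A → A)) ≤ ⊤ := le_top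
  exact fun κ _ => h fun f hf => absurd hf (Set.notMem_empty f)

namespace CongLattices

variable {A : Type*}

/-- The cycle of `f` through `x` has the maximal possible length `orderOf f`. -/
def IsFullPoint (f : Equiv.Perm A) (x : A) : Prop :=
  ∀ n : ℤ, (f ^ n) x = x → f ^ n = 1

theorem isFullPoint_of_minimalPeriod_eq {f : Equiv.Perm A} {x : A}
    (h : Function.minimalPeriod f x = orderOf f) : IsFullPoint f x := by
  intro n hn
  have h1 : f ^ n • x = x := hn
  rw [MulAction.zpow_smul_eq_iff_minimalPeriod_dvd] at h1
  have h2 : Function.minimalPeriod (f • ·) x = orderOf f := h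
  rw [h2] at h1
  exact orderOf_dvd_iff_zpow_eq_one.mp h1

theorem IsFullPoint.zpow_eq {f : Equiv.Perm A} {x : A} (hx : IsFullPoint f x) {i j : ℤ}
    (h : (f ^ i) x = (f ^ j) x) : f ^ i = f ^ j := by
  have h1 : (f ^ (-j + i)) x = x := by
    rw [zpow_add, Equiv.Perm.mul_apply, h, ← Equiv.Perm.mul_apply, ← zpow_add]
    simp
  have h2 := hx _ h1
  rw [zpow_add, zpow_neg, inv_mul_eq_one] at h2
  exact h2.symm

theorem IsFullPoint.apply {f : Equiv.Perm A} {x : A} (hx : IsFullPoint f x) :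
    IsFullPoint f (f x) := by
  intro n hn
  refine hx n (f.injective ?_)
  rwa [← Equiv.Perm.mul_apply, ← zpow_one_add, add_comm, zpow_add_one, Equiv.Perm.mul_apply]

/-- Folding the cycle of a full point `x` onto the cycle of an arbitrary point `z`,
equivariantly. -/
theorem IsFullPoint.exists_fold {f : Equiv.Perm A} {x : A} (hx : IsFullPoint f x) (z : A) :
    ∃ r : A → A, (∀ a, r (f a) = f (r a)) ∧ (∀ i : ℤ, r ((f ^ i) x) = (f ^ i) z) ∧
      ∀ a, ¬ f.SameCycle x a → r a = a := by
  classical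
  let r : A → A := fun a => if h : f.SameCycle x a then (f ^ h.choose) z else a
  have hin : ∀ i : ℤ, r ((f ^ i) x) = (f ^ i) z := by
    intro i
    have h : f.SameCycle x ((f ^ i) x) := ⟨i, rfl⟩
    simp only [r, dif_pos h]
    rw [hx.zpow_eq h.choose_spec]
  have hout : ∀ a, ¬ f.SameCycle x a → r a = a := fun a ha => dif_neg ha
  refine ⟨r, fun a => ?_, hin, hout⟩
  by_cases ha : f.SameCycle x a
  · obtain ⟨i, rfl⟩ := ha
    rw [hin, ← Equiv.Perm.mul_apply, ← Equiv.Perm.mul_apply, ← zpow_one_add, hin]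
  · rw [hout a ha, hout (f a) (by rwa [Equiv.Perm.sameCycle_apply_right])]

/-- The mappings preserving all congruences of `f` are compatible with equivariant mappings. -/
theorem apply_eq_of_equivariant {f g : A → A} (hg : ConSet A {f} ⊆ ConSet A {g})
    {r : A → A} (hr : ∀ a, r (f a) = f (r a)) {a b : A} (hab : r a = r b) :
    r (g a) = r (g b) := by
  have h : Setoid.ker r ∈ ConSet A {f} := by
    rintro _ rfl x y hxy
    rw [Setoid.ker_def] at hxy ⊢
    rw [hr, hr, hxy]
  exact hg h g rfl a b hab

/-- The mappings preserving all congruences of `f` either collapse or preserve an invariant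
subset. -/
theorem apply_eq_or_mem_of_invariant {f g : A → A} (hg : ConSet A {f} ⊆ ConSet A {g})
    {P : A → Prop} (hP : ∀ a, P a → P (f a)) {a b : A} (ha : P a) (hb : P b) :
    g a = g b ∨ (P (g a) ∧ P (g b)) := by
  let κ : Setoid A :=
    { r := fun a b => a = b ∨ (P a ∧ P b)
      iseqv :=
        ⟨fun _ => Or.inl rfl, fun h => h.imp Eq.symm And.symm, by
          rintro x y z (rfl | ⟨hx, hy⟩) (rfl | ⟨hy', hz⟩)
          · exact Or.inl rfl
          · exact Or.inr ⟨hy', hz⟩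
          · exact Or.inr ⟨hx, hy⟩
          · exact Or.inr ⟨hx, hz⟩⟩ }
  have h : κ ∈ ConSet A {f} := by
    rintro _ rfl x y (rfl | ⟨hx, hy⟩)
    · exact Or.inl rfl
    · exact Or.inr ⟨hP _ hx, hP _ hy⟩
  exact hg h g rfl a b (Or.inr ⟨ha, hb⟩)

/-- A mapping that preserves all congruences of `f` and moves a full point off its cycle is
constant. -/
theorem IsFullPoint.apply_eq_of_not_sameCycle [Finite A] (hA : 3 ≤ Nat.card A)
    {f : Equiv.Perm A} {g : A → A} (hg : ConSet A {(f : A → A)} ⊆ ConSet A {g})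
    {x y : A} (hx : IsFullPoint f x) (hy : IsFullPoint f y) (hxy : ¬ f.SameCycle x y)
    (hgx : ¬ f.SameCycle x (g x)) (w : A) : g w = g x := by
  have hinv : ∀ u a : A, f.SameCycle u a → f.SameCycle u (f a) := fun u a h => by
    rwa [Equiv.Perm.sameCycle_apply_right]
  have hcol : ∀ a, f.SameCycle x a → g a = g x := by
    intro a ha
    rcases apply_eq_or_mem_of_invariant hg (hinv x) ha (Equiv.Perm.SameCycle.refl f x) with h | h
    · exact h
    · exact absurd h.2 hgx
  have hfold : ∀ u, ¬ f.SameCycle x u → g u ≠ g x → ∀ x', IsFullPoint f x' → f.SameCycle x x' →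
      ∃ b : ℤ, g u = (f ^ b) x' ∧ g x = (f ^ b) u := by
    intro u hu hgu x' hx' hxx'
    obtain ⟨r, hr, hin, hout⟩ := hx'.exists_fold u
    have hout' : ∀ a, ¬ f.SameCycle x a → r a = a := fun a ha =>
      hout a fun h => ha (hxx'.trans h)
    have h0 : r x' = r u := by
      rw [hout' u hu]; simpa using hin 0
    have h1 := apply_eq_of_equivariant hg hr h0
    rw [hcol x' hxx', hout' _ hgx] at h1
    by_cases hb : f.SameCycle x' (g u)
    · obtain ⟨b, hb⟩ := hb
      refine ⟨b, hb.symm, ?_⟩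
      rw [h1, ← hb, hin]
    · rw [hout _ hb] at h1
      exact absurd h1.symm hgu
  by_cases hw : f.SameCycle x w
  · exact hcol w hw
  by_contra hgw
  obtain ⟨b, hb1, hb2⟩ := hfold w hw hgw x hx (Equiv.Perm.SameCycle.refl f x)
  have hwc : f.SameCycle w (g x) := ⟨b, hb2.symm⟩
  have hxgw : f.SameCycle x (g w) := ⟨b, hb1.symm⟩
  by_cases hthird : ∃ u, ¬ f.SameCycle x u ∧ ¬ f.SameCycle w u
  · obtain ⟨u, hu1, hu2⟩ := hthird
    have hgu : g u = g x := by
      by_contra hne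
      obtain ⟨b', -, hb'⟩ := hfold u hu1 hne x hx (Equiv.Perm.SameCycle.refl f x)
      exact hu2 (hwc.trans (Equiv.Perm.SameCycle.symm ⟨b', hb'.symm⟩))
    rcases apply_eq_or_mem_of_invariant hg
      (P := fun a => f.SameCycle w a ∨ f.SameCycle u a)
      (fun a h => h.imp (hinv w a) (hinv u a))
      (Or.inl (Equiv.Perm.SameCycle.refl f w)) (Or.inr (Equiv.Perm.SameCycle.refl f u)) with h | h
    · exact hgw (h.trans hgu)
    · rcases h.1 with h | h
      · exact hw (hxgw.trans h.symm)
      · exact hu1 (hxgw.trans h.symm)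
  · push Not at hthird
    obtain ⟨b', hb1', hb2'⟩ := hfold w hw hgw (f x) hx.apply
      (hinv x x (Equiv.Perm.SameCycle.refl f x))
    have e1 : f ^ b = f ^ (b' + 1) := hx.zpow_eq (by
      rw [← hb1, hb1', zpow_add_one, Equiv.Perm.mul_apply])
    obtain ⟨k, hk⟩ := hthird y hxy
    have e2 : (f ^ b') w = (f ^ (b' + 1)) w := by rw [← e1, ← hb2, hb2']
    have e3 : f w = w := by
      rw [zpow_add_one, Equiv.Perm.mul_apply] at e2
      exact ((f ^ b').injective e2).symm
    have e4 : f = 1 := by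
      have : (f ^ (1 : ℤ)) y = y := by
        rw [← hk, ← Equiv.Perm.mul_apply, ← zpow_add, add_comm, zpow_add, Equiv.Perm.mul_apply,
          zpow_one, e3]
      simpa using hy 1 this
    subst e4
    have hsub : (Set.univ : Set A) ⊆ {x, w} := by
      intro a _
      by_cases ha : (1 : Equiv.Perm A).SameCycle x a
      · left; simpa [eq_comm] using ha
      · right; simpa [eq_comm] using hthird a ha
    have h1 := Set.ncard_le_ncard hsub (Set.toFinite _)
    rw [Set.ncard_univ] at h1
    have h2 := Set.ncard_insert_le x {w}
    rw [Set.ncard_singleton] at h2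
    omega

/-- If `f` has two cycles of length `orderOf f`, a mapping preserving all congruences of `f` is a
power of `f` or constant. -/
theorem eq_zpow_or_const [Finite A] (hA : 3 ≤ Nat.card A)
    {f : Equiv.Perm A} {g : A → A} (hg : ConSet A {(f : A → A)} ⊆ ConSet A {g})
    {x y : A} (hx : IsFullPoint f x) (hy : IsFullPoint f y) (hxy : ¬ f.SameCycle x y) :
    (∃ j : ℤ, g = ⇑(f ^ j)) ∨ ∀ a b, g a = g b := by
  by_cases hc : ∀ u v, IsFullPoint f u → IsFullPoint f v → ¬ f.SameCycle u v →
      f.SameCycle u (g u)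
  · left
    have hyx : ¬ f.SameCycle y x := fun h => hxy h.symm
    have hgy := hc y x hy hx hyx
    obtain ⟨j, hj⟩ := hc x y hx hy hxy
    have key : ∀ u, IsFullPoint f u → (f ^ j) u = g u → ∀ w, ¬ f.SameCycle u w →
        ¬ f.SameCycle u (g w) → g w = (f ^ j) w := by
      intro u hu hgu w hw hgw
      obtain ⟨r, hr, hin, hout⟩ := hu.exists_fold w
      have h0 : r u = r w := by
        rw [hout w hw]; simpa using hin 0
      have h1 := apply_eq_of_equivariant hg hr h0
      rw [← hgu, hin, hout _ hgw] at h1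
      exact h1.symm
    have hjy : (f ^ j) y = g y :=
      (key x hx hj y hxy fun h => hxy (h.trans hgy.symm)).symm
    refine ⟨j, funext fun w => ?_⟩
    by_cases h1 : f.SameCycle x (g w)
    · have h2 : ¬ f.SameCycle y (g w) := fun h => hxy (h1.trans h.symm)
      by_cases h3 : f.SameCycle y w
      · exfalso
        rcases apply_eq_or_mem_of_invariant hg (P := f.SameCycle y)
          (fun a h => by rwa [Equiv.Perm.sameCycle_apply_right]) h3
          (Equiv.Perm.SameCycle.refl f y) with h | h
        · exact h2 (h ▸ hgy)
        · exact h2 h.1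
      · exact key y hy hjy w h3 h2
    · by_cases h3 : f.SameCycle x w
      · exfalso
        rcases apply_eq_or_mem_of_invariant hg (P := f.SameCycle x)
          (fun a h => by rwa [Equiv.Perm.sameCycle_apply_right]) h3
          (Equiv.Perm.SameCycle.refl f x) with h | h
        · exact h1 (h ▸ ⟨j, hj⟩)
        · exact h1 h.1
      · exact key x hx hj w h3 h1
  · right
    push Not at hc
    obtain ⟨u, v, hu, hv, huv, hgu⟩ := hc
    intro a b
    rw [hu.apply_eq_of_not_sameCycle hA hg hv huv hgu a,
      hu.apply_eq_of_not_sameCycle hA hg hv huv hgu b]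

theorem conSet_subset_iterate (f : A → A) (k : ℕ) : ConSet A {f} ⊆ ConSet A {f^[k]} := by
  rintro κ hκ _ rfl
  induction k with
  | zero => exact fun _ _ h => h
  | succ k ih =>
    intro x y h
    rw [Function.iterate_succ_apply', Function.iterate_succ_apply']
    exact hκ f rfl _ _ (ih x y h)

theorem conSet_subset_of_mem_zpowers [Finite A] {s t : Equiv.Perm A}
    (h : t ∈ Subgroup.zpowers s) : ConSet A {(s : A → A)} ⊆ ConSet A {(t : A → A)} := by
  rw [← mem_powers_iff_mem_zpowers] at h
  obtain ⟨n, rfl⟩ := h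
  have h1 : ((s ^ n : Equiv.Perm A) : A → A) = s^[n] := (Equiv.Perm.iterate_eq_pow s n).symm
  exact h1 ▸ conSet_subset_iterate s n

theorem exists_conSet_zpow_eq [Finite A] {f : Equiv.Perm A} {p m : ℕ} (hp : p.Prime)
    (hf : orderOf f = p ^ m) (j : ℤ) :
    ∃ v ≤ m, ConSet A {⇑(f ^ j)} = ConSet A {f^[p ^ v]} := by
  obtain ⟨v, hv, hd⟩ := (Nat.dvd_prime_pow hp).mp (Int.gcd_dvd_natAbs_right j ((p ^ m : ℕ) : ℤ))
  refine ⟨v, hv, ?_⟩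
  rw [Equiv.Perm.iterate_eq_pow]
  refine Set.Subset.antisymm (conSet_subset_of_mem_zpowers ?_) (conSet_subset_of_mem_zpowers ?_)
  · refine ⟨Int.gcdA j (p ^ m : ℕ), ?_⟩
    have h1 := Int.gcd_eq_gcd_ab j ((p ^ m : ℕ) : ℤ)
    have h2 : f ^ ((p ^ m : ℕ) : ℤ) = 1 := by rw [zpow_natCast, ← hf, pow_orderOf_eq_one]
    rw [← hd, ← zpow_natCast f, h1, zpow_add, zpow_mul, zpow_mul, h2]
    simp
  · obtain ⟨c, hc⟩ := Int.gcd_dvd_left j ((p ^ m : ℕ) : ℤ)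
    refine ⟨c, ?_⟩
    change (f ^ p ^ v) ^ c = f ^ j
    rw [← hd, ← zpow_natCast f, ← zpow_mul, ← hc]

theorem conSet_const {g : A → A} (hg : ∀ a b, g a = g b) : ConSet A {g} = Set.univ := by
  refine Set.eq_univ_of_forall ?_
  rintro κ _ rfl x y -
  rw [hg x y]

theorem conSet_iterate_orderOf (f : Equiv.Perm A) :
    ConSet A {f^[orderOf f]} = Set.univ := by
  refine Set.eq_univ_of_forall ?_
  rintro κ _ rfl x y h
  rw [Equiv.Perm.iterate_eq_pow, pow_orderOf_eq_one]
  exact h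

theorem conSet_iterate_prime_pow_mono (f : A → A) (p : ℕ) {v w : ℕ} (h : v ≤ w) :
    ConSet A {f^[p ^ v]} ⊆ ConSet A {f^[p ^ w]} := by
  obtain ⟨k, rfl⟩ := Nat.exists_eq_add_of_le h
  rw [pow_add, Function.iterate_mul]
  exact conSet_subset_iterate _ _

/-- The elements of `𝓔` above `Con(A,f)`. -/
theorem exists_eq_con_iterate [Finite A] (hA : 3 ≤ Nat.card A)
    {f : Equiv.Perm A} {p m : ℕ} (hp : p.Prime) (hf : orderOf f = p ^ m)
    {x y : A} (hx : IsFullPoint f x) (hy : IsFullPoint f y) (hxy : ¬ f.SameCycle x y)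
    {E : CongLattices A} (hE : con {(f : A → A)} ≤ E) :
    ∃ v : ℕ, E = con {f^[p ^ v]} := by
  classical
  obtain ⟨_, F, rfl⟩ := E
  have hF : ∀ g ∈ F, ∃ v : ℕ, ConSet A {g} = ConSet A {f^[p ^ v]} := by
    intro g hg
    have hsub : ConSet A {(f : A → A)} ⊆ ConSet A {g} := by
      rintro κ hκ _ rfl
      exact hE hκ _ hg
    rcases eq_zpow_or_const hA hsub hx hy hxy with ⟨j, rfl⟩ | hc
    · obtain ⟨v, -, h⟩ := exists_conSet_zpow_eq hp hf j
      exact ⟨v, h⟩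
    · exact ⟨m, by rw [conSet_const hc, ← hf, conSet_iterate_orderOf]⟩
  rcases F.eq_empty_or_nonempty with rfl | ⟨g₀, hg₀⟩
  · refine ⟨m, Subtype.ext ?_⟩
    change ConSet A ∅ = ConSet A {f^[p ^ m]}
    rw [← hf, conSet_iterate_orderOf]
    exact Set.eq_univ_of_forall fun _ _ h => h.elim
  · have hex : ∃ v, ∃ g ∈ F, ConSet A {g} = ConSet A {f^[p ^ v]} := by
      obtain ⟨v, hv⟩ := hF g₀ hg₀
      exact ⟨v, g₀, hg₀, hv⟩
    refine ⟨Nat.find hex, Subtype.ext (Set.Subset.antisymm ?_ ?_)⟩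
    · obtain ⟨g, hg, h⟩ := Nat.find_spec hex
      change ConSet A F ⊆ ConSet A {f^[p ^ Nat.find hex]}
      rw [← h]
      rintro κ hκ _ rfl
      exact hκ _ hg
    · intro κ hκ g hg
      obtain ⟨w, hw⟩ := hF g hg
      have h1 := conSet_iterate_prime_pow_mono f p (Nat.find_min' hex ⟨g, hg, hw⟩) hκ
      rw [← hw] at h1
      exact h1 g rfl

end CongLattices

theorem proposition4p4 {A : Type*} [Finite A] (hA : 3 ≤ Nat.card A)
    (f : Equiv.Perm A) (p m : ℕ) (hp : p.Prime) (hf : orderOf f = p ^ m)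
    (hcyc : ∃ x y : A, ¬ f.SameCycle x y ∧
      Function.minimalPeriod f x = p ^ m ∧ Function.minimalPeriod f y = p ^ m) :
    IsChain (· ≤ ·) (Set.Ici (CongLattices.con {(f : A → A)})) ∧
      ∀ E ∈ Set.Ici (CongLattices.con {(f : A → A)}),
        (E.carrier ≠ Set.univ → InfIrred E) ∧
          ∃ k : ℕ, 1 ≤ k ∧ E = CongLattices.con {f^[k]} := by
  obtain ⟨x, y, hxy, hx, hy⟩ := hcyc
  have key : ∀ E, CongLattices.con {(f : A → A)} ≤ E →
      ∃ v : ℕ, E = CongLattices.con {f^[p ^ v]} := fun E hE =>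
    CongLattices.exists_eq_con_iterate hA hp hf
      (CongLattices.isFullPoint_of_minimalPeriod_eq (hx.trans hf.symm))
      (CongLattices.isFullPoint_of_minimalPeriod_eq (hy.trans hf.symm)) hxy hE
  have total : ∀ E E', CongLattices.con {(f : A → A)} ≤ E → CongLattices.con {(f : A → A)} ≤ E' →
      E ≤ E' ∨ E' ≤ E := by
    intro E E' hE hE'
    obtain ⟨v, rfl⟩ := key E hE
    obtain ⟨w, rfl⟩ := key E' hE'
    exact (le_total v w).imp (CongLattices.conSet_iterate_prime_pow_mono f p)
      (CongLattices.conSet_iterate_prime_pow_mono f p)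
  refine ⟨fun E hE E' hE' _ => total E E' hE hE', fun E hE => ⟨fun hne => ⟨?_, ?_⟩, ?_⟩⟩
  · intro hmax
    refine hne (Set.eq_univ_of_univ_subset ?_)
    rw [← CongLattices.carrier_top]
    exact hmax le_top
  · rintro b c rfl
    rcases total b c (le_trans hE inf_le_left) (le_trans hE inf_le_right) with h | h
    · exact Or.inl (inf_eq_left.mpr h).symm
    · exact Or.inr (inf_eq_right.mpr h).symm
  · obtain ⟨v, hv⟩ := key E hE
    exact ⟨p ^ v, Nat.one_le_iff_ne_zero.mpr (pow_ne_zero v hp.ne_zero), hv⟩
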